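/- Let $N\ge 2$ and let $\Phi=\{\varphi_i\}_{i=1}^M$ be a unit-norm frame for $\mathbb R^N$, that is, $\|\varphi_i\|_2=1$ for all $i$ and there are constants $0<A\le B$ with $A\|x\|^2\le\sum_{i=1}^M|\langle x,\varphi_i\rangle|^2\le B\|x\|^2$ for all $x\in\mathbb R^N$. Let $$D_\Phi=\min_{c_1,\dots,c_M\ge 0}\Big\|\sum_{i=1}^M c_i\varphi_i\varphi_i^T-I\Big\|_F$$ be the Frobenius-norm distance of the identity matrix to the cone generated by the matrices $\varphi_i\varphi_i^T$, and let $V_\Phi=\operatorname{Vol}(E_\Phi)/\omega_N$, where $E_\Phi$ is the ellipsoid of minimal volume containing the convex hull of $\{\pm\varphi_i\}_{i=1}^M$ and $\omega_N$ is the volume of the unit ball of $\mathbb R^N$. Then $$\frac{N(1-D_\Phi^2)}{N-D_\Phi^2}\;\le\; V_\Phi^{4/N}\;\le\;\frac{N(N-1-D_\Phi^2)}{(N-1)(N-D_\Phi^2)}\;\le\;1,$$ where the leftmost inequality is asserted under the condition $D_\Phi<1$. Consequently, for fixed $N$, $V_\Phi\to1$ is equivalent to $D_\Phi\to0$: if $(\Phi_k)_k$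 is any sequence (or any family indexed by a set with a filter) of unit-norm frames for $\mathbb R^N$, with possibly varying numbers of vectors, then $V_{\Phi_k}\to1$ if and only if $D_{\Phi_k}\to0$. -/

import Mathlib

open scoped Matrix Topology
open MeasureTheory Filter

noncomputable section

namespace UnitFrame

/-- The Euclidean space `ℝ^N`. -/
abbrev E (N : ℕ) : Type := EuclideanSpace ℝ (Fin N)

/-- A finite sequence of vectors is a frame for `ℝ^N` if it has frame bounds `0 < A ≤ B`. -/
def IsFrame {M N : ℕ} (Φ : Fin M → E N) : Prop :=
  ∃ A B : ℝ, 0 < A ∧ A ≤ B ∧ ∀ x : E N,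
    A * ‖x‖ ^ 2 ≤ ∑ i, |inner ℝ x (Φ i)| ^ 2 ∧
      ∑ i, |inner ℝ x (Φ i)| ^ 2 ≤ B * ‖x‖ ^ 2

/-- The class of unit norm frames of `M` vectors in `ℝ^N`. -/
def IsUnitNormFrame {M N : ℕ} (Φ : Fin M → E N) : Prop :=
  IsFrame Φ ∧ ∀ i, ‖Φ i‖ = 1

section Frobenius

attribute [local instance] Matrix.frobeniusNormedAddCommGroup

/-- The distance, in the Frobenius norm, of the identity matrix to the cone
`{∑ i, c i • φ i (φ i)ᵀ : c ≥ 0}`. This (closed) cone contains `0`, so the infimum is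
taken over a nonempty set of nonnegative numbers. -/
def coneDist {M N : ℕ} (Φ : Fin M → E N) : ℝ :=
  ⨅ c : {c : Fin M → ℝ // ∀ i, 0 ≤ c i},
    ‖(∑ i, c.1 i • Matrix.vecMulVec (Φ i).ofLp (Φ i).ofLp) - (1 : Matrix (Fin N) (Fin N) ℝ)‖

end Frobenius

/-- The set `{v : ⟨X (v - c), v - c⟩ ≤ 1}`. -/
def ellipsoid {N : ℕ} (X : Matrix (Fin N) (Fin N) ℝ) (c : E N) : Set (E N) :=
  {v | (X *ᵥ (v - c).ofLp) ⬝ᵥ (v - c).ofLp ≤ 1}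

/-- Ellipsoids in `ℝ^N`, with arbitrary centre. -/
def IsEllipsoid {N : ℕ} (S : Set (E N)) : Prop :=
  ∃ (X : Matrix (Fin N) (Fin N) ℝ) (c : E N), X.PosDef ∧ S = ellipsoid X c

/-- `S` is an ellipsoid of minimal volume among all ellipsoids containing `K`. -/
def IsMinimalEllipsoid {N : ℕ} (K S : Set (E N)) : Prop :=
  IsEllipsoid S ∧ K ⊆ S ∧ ∀ T : Set (E N), IsEllipsoid T → K ⊆ T → volume S ≤ volume T

/-- The symmetrized sequence `{φ i} ∪ {-φ i}`. -/
def symmetrization {M N : ℕ} (Φ : Fin M → E N) : Set (E N) :=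
  Set.range Φ ∪ Set.range (fun i => -Φ i)

/-- The minimal (Löwner) ellipsoid of `Φ`: the ellipsoid of minimal volume that contains the
convex hull of the symmetrization of `Φ`. (It exists and is unique when `Φ` is a frame.) -/
def minimalEllipsoid {M N : ℕ} (Φ : Fin M → E N) : Set (E N) :=
  Classical.epsilon (IsMinimalEllipsoid (convexHull ℝ (symmetrization Φ)))

/-- The volume of the minimal ellipsoid of `Φ`, divided by the volume of the unit ball. -/
def normalizedVolume {M N : ℕ} (Φ : Fin M → E N) : ℝ :=
  (volume (minimalEllipsoid Φ)).toReal / (volume (Metric.closedBall (0 : E N) 1)).toReal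

end UnitFrame

end

/-! Write `S(c) = ∑ c_i φ_i φ_iᵀ`, whose trace is `∑ c_i` for unit vectors. A weight `c` maximizing
`det S(c)` among weights of sum `N` (a D-optimal design) solves the problem dual to the Löwner
ellipsoid: the minimal ellipsoid is `{v : vᵀ S(c)⁻¹ v ≤ 1}`. Hence `V = √(det S(c))`, and `W :=
V^(4/N) = (det S(c))^(2/N)`.

Upper bound on `W`: projecting `I` onto the ray through `S(c)` gives `D² ≤ N - N²/q` with `q = tr
S(c)²`, while AM-GM on products of pairs of eigenvalues gives `N(N-1)W ≤ N² - q`. Eliminate `q`.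

Lower bound on `W`: for any `d ≥ 0` let `p = tr S(d)` and `r = tr S(d)²`. Kober's inequality for the
eigenvalues and optimality, `N² (det S(d))^(2/N) ≤ p² W`, give `(N-W) p² ≤ N(N-1) r`. Minimizing
`‖S(d) - I‖² = r - 2p + N` under this constraint yields `D² ≥ N(1-W)/(N-W)`. The two bounds together
control `D²` and `1 - W` by each other up to constants in `N`. -/

/-! ### Scalar inequalities of AM-GM type. -/

/-- Jensen's inequality for `u ↦ (exp u - t) ^ 2` on `[log t, ∞)`. -/
theorem Real.card_mul_geom_mean_sub_sq_le {ι : Type*} (s : Finset ι) (hs : s.Nonempty)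
    (x : ι → ℝ) {t : ℝ} (ht : 0 < t) (hx : ∀ i ∈ s, t ≤ x i) :
    (s.card : ℝ) * ((∏ i ∈ s, x i) ^ (1 / (s.card : ℝ)) - t) ^ 2 ≤ ∑ i ∈ s, (x i - t) ^ 2 := by
  have hm : (0 : ℝ) < s.card := by exact_mod_cast hs.card_pos
  have hpos : ∀ i ∈ s, 0 < x i := fun i hi => ht.trans_le (hx i hi)
  have hconv : ConvexOn ℝ (Set.Ici (Real.log t)) (fun u => (Real.exp u - t) ^ 2) := by
    -- On `[log t, ∞)` the convex function `exp u - t` is nonnegative, so its square is convex.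
    refine ConvexOn.pow (f := fun u => Real.exp u - t) ?_ ?_ 2
    · exact (convexOn_exp.subset (Set.subset_univ _) (convex_Ici _)).sub
        (concaveOn_const t (convex_Ici _))
    · intro u hu
      have := Real.exp_le_exp.mpr (Set.mem_Ici.mp hu)
      rw [Real.exp_log ht] at this
      simpa using this
  have key := hconv.map_sum_le (t := s) (w := fun _ => 1 / (s.card : ℝ))
    (p := fun i => Real.log (x i)) (fun _ _ => by positivity)
    (by simp [hm.ne']) (fun i hi => Real.log_le_log ht (hx i hi))
  have hexp : Real.exp (∑ i ∈ s, (1 / (s.card : ℝ)) • Real.log (x i))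
      = (∏ i ∈ s, x i) ^ (1 / (s.card : ℝ)) := by
    rw [Real.rpow_def_of_pos (Finset.prod_pos hpos), Real.log_prod fun i hi => (hpos i hi).ne',
      ← Finset.smul_sum, smul_eq_mul, mul_comm]
  have hsum : ∑ i ∈ s, (1 / (s.card : ℝ)) • (Real.exp (Real.log (x i)) - t) ^ 2
      = (∑ i ∈ s, (x i - t) ^ 2) / s.card := by
    rw [← Finset.smul_sum, smul_eq_mul, one_div, div_eq_inv_mul]
    congr 1
    exact Finset.sum_congr rfl fun i hi => by rw [Real.exp_log (hpos i hi)]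
  simp only [hexp, hsum] at key
  rwa [le_div_iff₀ hm, mul_comm] at key

/-- Two-term weighted AM-GM with weights `(m+1)/(2m)` and `(m-1)/(2m)`. It handles the cross term in
the induction for Kober's inequality. -/
theorem Real.two_mul_mul_geom_mean_le {m : ℕ} (hm : 1 ≤ m) {t Q : ℝ} (ht : 0 ≤ t) (hQ : 0 ≤ Q) :
    2 * (m : ℝ) * (Q ^ (1 / (m : ℝ)) * t)
      ≤ ((m : ℝ) + 1) * (t * Q) ^ (2 / ((m : ℝ) + 1)) + ((m : ℝ) - 1) * t ^ 2 := by
  have hm' : (1 : ℝ) ≤ m := by exact_mod_cast hm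
  have hm0 : (0 : ℝ) < m := by linarith
  have h := Real.geom_mean_le_arith_mean2_weighted (w₁ := ((m : ℝ) + 1) / (2 * m))
    (w₂ := ((m : ℝ) - 1) / (2 * m)) (p₁ := (t * Q) ^ (2 / ((m : ℝ) + 1))) (p₂ := t ^ 2)
    (by positivity) (div_nonneg (by linarith) (by positivity)) (by positivity) (by positivity)
    (by field_simp; ring)
  have e1 : ((t * Q) ^ (2 / ((m : ℝ) + 1))) ^ (((m : ℝ) + 1) / (2 * m))
      = t ^ (1 / (m : ℝ)) * Q ^ (1 / (m : ℝ)) := by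
    rw [← Real.rpow_mul (by positivity), ← Real.mul_rpow ht hQ]
    congr 1
    field_simp
  have e2 : (t ^ 2) ^ (((m : ℝ) - 1) / (2 * m)) = t ^ (((m : ℝ) - 1) / m) := by
    rw [← Real.rpow_natCast t 2, ← Real.rpow_mul ht]
    congr 1
    push_cast
    field_simp
  have e3 : t ^ (1 / (m : ℝ)) * t ^ (((m : ℝ) - 1) / m) = t := by
    rw [← Real.rpow_add_of_nonneg ht (by positivity) (div_nonneg (by linarith) hm0.le)]
    have : 1 / (m : ℝ) + ((m : ℝ) - 1) / m = 1 := by field_simp; ring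
    rw [this, Real.rpow_one]
  rw [e1, e2] at h
  have h' : Q ^ (1 / (m : ℝ)) * t ≤ ((m : ℝ) + 1) / (2 * m) * (t * Q) ^ (2 / ((m : ℝ) + 1))
      + ((m : ℝ) - 1) / (2 * m) * t ^ 2 := by
    calc Q ^ (1 / (m : ℝ)) * t
        = t ^ (1 / (m : ℝ)) * Q ^ (1 / (m : ℝ)) * t ^ (((m : ℝ) - 1) / m) := by
          conv_lhs => rw [← e3]
          ring
      _ ≤ _ := h
  calc 2 * (m : ℝ) * (Q ^ (1 / (m : ℝ)) * t)
      ≤ 2 * (m : ℝ) * (((m : ℝ) + 1) / (2 * m) * (t * Q) ^ (2 / ((m : ℝ) + 1))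
        + ((m : ℝ) - 1) / (2 * m) * t ^ 2) := by gcongr
    _ = _ := by field_simp

/-- **Kober's inequality**. -/
theorem Real.sq_sum_le_kober {ι : Type*} (s : Finset ι) (x : ι → ℝ) (hx : ∀ i ∈ s, 0 ≤ x i) :
    (∑ i ∈ s, x i) ^ 2
      ≤ ((s.card : ℝ) - 1) * ∑ i ∈ s, x i ^ 2
        + s.card * (∏ i ∈ s, x i) ^ (2 / (s.card : ℝ)) := by
  classical
  -- Splitting off the smallest value makes the remaining ones at least `x a`, as the Jensen bound
  -- requires.
  induction s using Finset.induction_on_min_value x with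
  | empty => simp
  | insert a s ha hmin ih =>
    have ht : 0 ≤ x a := hx a (Finset.mem_insert_self a s)
    have hs : ∀ i ∈ s, 0 ≤ x i := fun i hi => hx i (Finset.mem_insert_of_mem hi)
    rw [Finset.sum_insert ha, Finset.sum_insert ha, Finset.prod_insert ha,
      Finset.card_insert_of_notMem ha]
    rcases s.eq_empty_or_nonempty with rfl | hne
    · simp
    have hm : 1 ≤ s.card := hne.card_pos
    have hm' : (1 : ℝ) ≤ s.card := by exact_mod_cast hm
    push_cast
    rcases ht.eq_or_lt with h0 | hpos
    -- If the minimum is `0` the product vanishes and Cauchy-Schwarz suffices.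
    · have := sq_sum_le_card_mul_sum_sq (s := s) (f := x)
      rw [← h0, zero_mul, Real.zero_rpow (by positivity)]
      simpa using this
    · have ih' := ih hs
      have hQ : 0 ≤ ∏ i ∈ s, x i := Finset.prod_nonneg hs
      have hA := Real.card_mul_geom_mean_sub_sq_le s hne x hpos hmin
      have hB := Real.two_mul_mul_geom_mean_le hm ht hQ
      have hg : (∏ i ∈ s, x i) ^ (2 / (s.card : ℝ))
          = ((∏ i ∈ s, x i) ^ (1 / (s.card : ℝ))) ^ 2 := by
        rw [← Real.rpow_natCast, ← Real.rpow_mul hQ]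
        congr 1
        push_cast
        ring
      have hexp : ∑ i ∈ s, (x i - x a) ^ 2
          = ∑ i ∈ s, x i ^ 2 - 2 * x a * ∑ i ∈ s, x i + s.card * x a ^ 2 := by
        simp only [sub_sq, Finset.sum_add_distrib, Finset.sum_sub_distrib, Finset.mul_sum,
          Finset.sum_const, nsmul_eq_mul]
        congr 2
        exact Finset.sum_congr rfl fun i _ => by ring
      rw [hg] at ih'
      rw [hexp] at hA
      nlinarith [ih', hA, hB]

/-- The arithmetic-geometric mean inequality for the products of pairs. -/
theorem Real.prod_rpow_two_div_card_le {ι : Type*} [Fintype ι] (hι : 2 ≤ Fintype.card ι)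
    (x : ι → ℝ) (hx : ∀ i, 0 ≤ x i) :
    (Fintype.card ι : ℝ) * ((Fintype.card ι : ℝ) - 1)
        * (∏ i, x i) ^ (2 / (Fintype.card ι : ℝ))
      ≤ (∑ i, x i) ^ 2 - ∑ i, x i ^ 2 := by
  classical
  obtain ⟨n, hn⟩ : ∃ n, Fintype.card ι = n + 2 := ⟨_, (Nat.sub_add_cancel hι).symm⟩
  have herase : ∀ i : ι, (Finset.univ.erase i).card = n + 1 := fun i => by
    rw [Finset.card_erase_of_mem (Finset.mem_univ i), Finset.card_univ, hn]
    rfl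
  set P := ∏ i, x i with hP
  have hP0 : 0 ≤ P := Finset.prod_nonneg fun i _ => hx i
  -- Ordered pairs of distinct indices: `(n+2)(n+1)` of them, each index occurring in `2(n+1)`.
  let T : Finset (Σ _ : ι, ι) := Finset.univ.sigma fun i => Finset.univ.erase i
  have hT : (∑ p ∈ T, (1 : ℝ)) = ((n : ℝ) + 2) * (n + 1) := by
    rw [Finset.sum_const, nsmul_eq_mul, mul_one, Finset.card_sigma]
    simp only [herase, Finset.sum_const, Finset.card_univ, hn]
    simp
  have hprod : ∏ p ∈ T, (x p.1 * x p.2) ^ (1 : ℝ) = P ^ (2 * n + 2) := by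
    simp only [Real.rpow_one]
    rw [Finset.prod_sigma]
    have : ∀ i : ι, ∏ j ∈ Finset.univ.erase i, x i * x j = x i ^ n * P := fun i => by
      rw [Finset.prod_mul_distrib, Finset.prod_const, herase, pow_succ, mul_assoc,
        Finset.mul_prod_erase _ _ (Finset.mem_univ i)]
    simp only [this]
    rw [Finset.prod_mul_distrib, Finset.prod_pow, Finset.prod_const, Finset.card_univ, hn]
    ring
  have hsum : ∑ p ∈ T, (1 : ℝ) * (x p.1 * x p.2) = (∑ i, x i) ^ 2 - ∑ i, x i ^ 2 := by
    simp only [one_mul]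
    rw [Finset.sum_sigma, sq, Finset.sum_mul, ← Finset.sum_sub_distrib]
    refine Finset.sum_congr rfl fun i _ => ?_
    change ∑ j ∈ Finset.univ.erase i, x i * x j = _
    rw [← Finset.mul_sum, ← Finset.add_sum_erase _ _ (Finset.mem_univ i)]
    ring
  have h := Real.geom_mean_le_arith_mean T (fun _ => 1) (fun p => x p.1 * x p.2)
    (fun _ _ => zero_le_one) (by rw [hT]; positivity) (fun p _ => mul_nonneg (hx _) (hx _))
  rw [hprod, hsum, hT, ← Real.rpow_natCast, ← Real.rpow_mul hP0,
    le_div_iff₀ (by positivity)] at h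
  rw [hn]
  have e : ((2 * n + 2 : ℕ) : ℝ) * (((n : ℝ) + 2) * (n + 1))⁻¹ = 2 / ((n + 2 : ℕ) : ℝ) := by
    push_cast
    field_simp
  rw [e] at h
  calc _ = P ^ (2 / ((n + 2 : ℕ) : ℝ)) * (((n : ℝ) + 2) * (n + 1)) := by push_cast; ring
    _ ≤ _ := h

/-! ### Trace, determinant and Frobenius norm of positive semidefinite matrices. -/

namespace Matrix

open scoped MatrixOrder

variable {n : Type*} [Fintype n] [DecidableEq n]

theorem IsHermitian.trace_mul_self_eq_sum_sq_eigenvalues {A : Matrix n n ℝ}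
    (hA : A.IsHermitian) : (A * A).trace = ∑ i, hA.eigenvalues i ^ 2 := by
  have h := congrArg (fun B => (B * B).trace) hA.spectral_theorem
  simp only [← map_mul] at h
  rw [h, Unitary.conjStarAlgAut_apply, trace_mul_cycle, Unitary.coe_star_mul_self, one_mul,
    diagonal_mul_diagonal, trace_diagonal]
  simp [sq]

theorem PosSemidef.exists_factor {A : Matrix n n ℝ} (hA : A.PosSemidef) :
    ∃ B : Matrix n n ℝ, A = Bᵀ * B := by
  obtain ⟨B, hB⟩ := CStarAlgebra.nonneg_iff_eq_star_mul_self.mp hA.nonneg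
  exact ⟨B, by simpa [star_eq_conjTranspose] using hB⟩

theorem PosSemidef.det_le_trace_div_pow {A : Matrix n n ℝ} (hA : A.PosSemidef) :
    A.det ≤ (A.trace / Fintype.card n) ^ Fintype.card n := by
  rcases isEmpty_or_nonempty n with hn | hn
  · simp
  have hc : (0 : ℝ) < Fintype.card n := by exact_mod_cast Fintype.card_pos
  have h0 : 0 ≤ ∏ i, hA.1.eigenvalues i := Finset.prod_nonneg fun i _ => hA.eigenvalues_nonneg i
  have h := Real.geom_mean_le_arith_mean Finset.univ (fun _ => 1) hA.1.eigenvalues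
    (fun _ _ => zero_le_one) (by simpa using hc) (fun i _ => hA.eigenvalues_nonneg i)
  simp only [Real.rpow_one, Finset.sum_const, Finset.card_univ, nsmul_eq_mul, mul_one,
    one_mul] at h
  rw [hA.1.det_eq_prod_eigenvalues, hA.1.trace_eq_sum_eigenvalues]
  simp only [RCLike.ofReal_real_eq_id, id]
  calc ∏ i, hA.1.eigenvalues i
      = ((∏ i, hA.1.eigenvalues i) ^ ((Fintype.card n : ℝ)⁻¹)) ^ Fintype.card n :=
        (Real.rpow_inv_natCast_pow h0 Fintype.card_ne_zero).symm
    _ ≤ _ := by gcongr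

/-- With `X = BᵀB`, this is AM-GM for the eigenvalues of `B Y Bᵀ`. -/
theorem PosSemidef.det_mul_det_le {X Y : Matrix n n ℝ} (hX : X.PosSemidef) (hY : Y.PosSemidef) :
    X.det * Y.det ≤ ((X * Y).trace / Fintype.card n) ^ Fintype.card n := by
  obtain ⟨B, rfl⟩ := hX.exists_factor
  have h := (hY.mul_mul_conjTranspose_same B).det_le_trace_div_pow
  rw [conjTranspose_eq_transpose_of_trivial] at h
  calc (Bᵀ * B).det * Y.det = (B * Y * Bᵀ).det := by simp only [det_mul]; ring
    _ ≤ _ := h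
    _ = _ := by rw [trace_mul_cycle]

/-- Kober's inequality for the eigenvalues of a positive semidefinite matrix. -/
theorem PosSemidef.sq_trace_le_kober {A : Matrix n n ℝ} (hA : A.PosSemidef) :
    A.trace ^ 2 ≤ ((Fintype.card n : ℝ) - 1) * (A * A).trace
      + Fintype.card n * A.det ^ (2 / (Fintype.card n : ℝ)) := by
  have h := Real.sq_sum_le_kober Finset.univ hA.1.eigenvalues fun i _ => hA.eigenvalues_nonneg i
  rw [hA.1.det_eq_prod_eigenvalues, hA.1.trace_eq_sum_eigenvalues,
    hA.1.trace_mul_self_eq_sum_sq_eigenvalues]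
  simpa using h

theorem PosSemidef.det_rpow_two_div_card_le {A : Matrix n n ℝ} (hA : A.PosSemidef)
    (hn : 2 ≤ Fintype.card n) :
    (Fintype.card n : ℝ) * ((Fintype.card n : ℝ) - 1) * A.det ^ (2 / (Fintype.card n : ℝ))
      ≤ A.trace ^ 2 - (A * A).trace := by
  have h := Real.prod_rpow_two_div_card_le hn hA.1.eigenvalues hA.eigenvalues_nonneg
  rw [hA.1.det_eq_prod_eigenvalues, hA.1.trace_eq_sum_eigenvalues,
    hA.1.trace_mul_self_eq_sum_sq_eigenvalues]
  simpa using h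

theorem det_add_smul_vecMulVec {A : Matrix n n ℝ} (hA : IsUnit A.det) (s : ℝ) (v : n → ℝ) :
    (A + s • vecMulVec v v).det = A.det * (1 + s * (A⁻¹ *ᵥ v ⬝ᵥ v)) := by
  have h := det_add_replicateCol_mul_replicateRow (ι := Unit) hA (s • v) v
  rw [← vecMulVec_eq, smul_vecMulVec, det_unique (n := Unit), add_apply 1,
    one_apply_eq, ← replicateRow_vecMul, replicateRow_mul_replicateCol_apply, dotProduct_smul,
    ← dotProduct_mulVec, dotProduct_comm, smul_eq_mul] at h
  exact h

section Frobenius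

attribute [local instance] Matrix.frobeniusNormedAddCommGroup

theorem frobenius_norm_sub_one_sq {A : Matrix n n ℝ} (hA : A.IsHermitian) :
    ‖A - 1‖ ^ 2 = (A * A).trace - 2 * A.trace + Fintype.card n := by
  have h1 : ‖A - 1‖ ^ 2 = ((A - 1) * (A - 1)).trace := by
    rw [frobenius_norm_def, ← Real.rpow_natCast, ← Real.rpow_mul (by positivity)]
    have hs : (A - 1)ᵀ = A - 1 := by
      have := hA.eq
      rw [conjTranspose_eq_transpose_of_trivial] at this
      rw [transpose_sub, this, transpose_one]
    norm_num
    rw [trace]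
    refine Finset.sum_congr rfl fun i _ => ?_
    rw [diag_apply, mul_apply]
    refine Finset.sum_congr rfl fun j _ => ?_
    conv_rhs => rw [← congrFun (congrFun hs i) j, transpose_apply]
    conv_lhs => rw [← Matrix.sub_apply, ← congrFun (congrFun hs i) j, transpose_apply]
    ring
  rw [h1, sub_mul, mul_sub, mul_one, one_mul, trace_sub, trace_sub, trace_sub, trace_one]
  ring

end Frobenius

end Matrix

/-! ### Frame matrices and D-optimal designs. -/

namespace UnitFrame

variable {M N : ℕ} {Φ : Fin M → E N}

/-- The matrix `∑ i, c i • φ i (φ i)ᵀ`. -/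
def frameMatrix (Φ : Fin M → E N) (c : Fin M → ℝ) : Matrix (Fin N) (Fin N) ℝ :=
  ∑ i, c i • Matrix.vecMulVec (Φ i).ofLp (Φ i).ofLp

theorem frameMatrix_smul (Φ : Fin M → E N) (a : ℝ) (c : Fin M → ℝ) :
    frameMatrix Φ (a • c) = a • frameMatrix Φ c := by
  simp [frameMatrix, Finset.smul_sum, smul_smul]

theorem frameMatrix_add_single (Φ : Fin M → E N) (c : Fin M → ℝ) (s : ℝ) (i : Fin M) :
    frameMatrix Φ (c + Pi.single i s)
      = frameMatrix Φ c + s • Matrix.vecMulVec (Φ i).ofLp (Φ i).ofLp := by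
  simp only [frameMatrix, Pi.add_apply, add_smul, Finset.sum_add_distrib]
  congr 1
  rw [Finset.sum_eq_single i (fun j _ hj => by simp [hj]) (by simp)]
  simp

theorem posSemidef_frameMatrix (Φ : Fin M → E N) {c : Fin M → ℝ} (hc : ∀ i, 0 ≤ c i) :
    (frameMatrix Φ c).PosSemidef := by
  refine Matrix.posSemidef_sum _ fun i _ => ?_
  have := (Matrix.posSemidef_vecMulVec_self_star (Φ i).ofLp).smul (hc i)
  simpa using this

theorem continuous_frameMatrix (Φ : Fin M → E N) : Continuous (frameMatrix Φ) := by
  unfold frameMatrix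
  fun_prop

theorem dotProduct_self_eq_norm_sq (v : E N) : v.ofLp ⬝ᵥ v.ofLp = ‖v‖ ^ 2 := by
  rw [EuclideanSpace.real_norm_sq_eq, dotProduct]
  exact Finset.sum_congr rfl fun i _ => by ring

theorem trace_mul_frameMatrix (X : Matrix (Fin N) (Fin N) ℝ) (c : Fin M → ℝ) :
    (X * frameMatrix Φ c).trace = ∑ i, c i * (X *ᵥ (Φ i).ofLp ⬝ᵥ (Φ i).ofLp) := by
  simp [frameMatrix, Finset.mul_sum, Matrix.trace_sum, Matrix.mul_vecMulVec,
    Matrix.trace_vecMulVec]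

theorem trace_frameMatrix (hΦ : ∀ i, ‖Φ i‖ = 1) (c : Fin M → ℝ) :
    (frameMatrix Φ c).trace = ∑ i, c i := by
  have := trace_mul_frameMatrix (Φ := Φ) 1 c
  simpa [dotProduct_self_eq_norm_sq, hΦ] using this

theorem posDef_frameMatrix_one (hΦ : IsFrame Φ) : (frameMatrix Φ 1).PosDef := by
  obtain ⟨A, B, hA, -, h⟩ := hΦ
  refine Matrix.PosDef.of_dotProduct_mulVec_pos
    (posSemidef_frameMatrix Φ fun _ => zero_le_one).1 fun x hx => ?_
  have hx' : WithLp.toLp 2 x ≠ 0 := by simpa using hx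
  have hpos : 0 < A * ‖WithLp.toLp 2 x‖ ^ 2 := by positivity
  refine hpos.trans_le ((h (WithLp.toLp 2 x)).1.trans_eq ?_)
  simp only [frameMatrix, Pi.one_apply, one_smul, Matrix.sum_mulVec, dotProduct_sum,
    Matrix.vecMulVec_mulVec, star_trivial, sq_abs]
  refine Finset.sum_congr rfl fun i _ => ?_
  simp [EuclideanSpace.inner_eq_star_dotProduct, sq, dotProduct_comm]

/-- A D-optimal design: the weights maximizing the determinant of the frame matrix. -/
theorem exists_det_frameMatrix_max (hN : 0 < N) (hΦ : IsFrame Φ) :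
    ∃ c : Fin M → ℝ, (∀ i, 0 ≤ c i) ∧ ∑ i, c i = N ∧ 0 < (frameMatrix Φ c).det ∧
      ∀ d : Fin M → ℝ, (∀ i, 0 ≤ d i) →
        (N : ℝ) ^ N * (frameMatrix Φ d).det ≤ (∑ i, d i) ^ N * (frameMatrix Φ c).det := by
  have hN' : (0 : ℝ) < N := by exact_mod_cast hN
  have hdet1 := (posDef_frameMatrix_one hΦ).det_pos
  have hM : 0 < M := by
    rcases Nat.eq_zero_or_pos M with rfl | h
    · have : NeZero N := ⟨hN.ne'⟩
      simp [frameMatrix] at hdet1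
    · exact h
  have hM' : (0 : ℝ) < M := by exact_mod_cast hM
  have : NeZero M := ⟨hM.ne'⟩
  have hscale : ∀ (a : ℝ) (d : Fin M → ℝ),
      (frameMatrix Φ (a • d)).det = a ^ N * (frameMatrix Φ d).det := fun a d => by
    rw [frameMatrix_smul, Matrix.det_smul, Fintype.card_fin]
  -- Maximize on the compact simplex; homogeneity of degree `N` carries the bound to the whole cone.
  obtain ⟨c, hc, hmax⟩ := (isCompact_stdSimplex ℝ (Fin M)).exists_isMaxOn
    ⟨_, single_mem_stdSimplex ℝ (0 : Fin M)⟩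
    ((continuous_frameMatrix Φ).matrix_det).continuousOn
  have hmax' : ∀ d : Fin M → ℝ, (∀ i, 0 ≤ d i) →
      (frameMatrix Φ d).det ≤ (∑ i, d i) ^ N * (frameMatrix Φ c).det := by
    intro d hd
    rcases (Finset.sum_nonneg fun i _ => hd i).eq_or_lt with h0 | hpos
    · have hd0 : d = (0 : ℝ) • d := by
        rw [zero_smul]
        funext i
        exact (Finset.sum_eq_zero_iff_of_nonneg fun i _ => hd i).mp h0.symm i (Finset.mem_univ i)
      rw [hd0, hscale]
      simp [hN.ne']
    · have hmem : (∑ i, d i)⁻¹ • d ∈ stdSimplex ℝ (Fin M) :=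
        ⟨fun i => mul_nonneg (inv_nonneg.mpr hpos.le) (hd i), by
          simp only [Pi.smul_apply, smul_eq_mul, ← Finset.mul_sum]
          exact inv_mul_cancel₀ hpos.ne'⟩
      have h : (frameMatrix Φ ((∑ i, d i)⁻¹ • d)).det ≤ (frameMatrix Φ c).det := hmax hmem
      rw [hscale, inv_pow, inv_mul_le_iff₀ (by positivity)] at h
      exact h
  have hcpos : 0 < (frameMatrix Φ c).det := by
    have h := hdet1.trans_le (hmax' 1 fun _ => zero_le_one)
    exact pos_of_mul_pos_right h (by simp)
  refine ⟨(N : ℝ) • c, fun i => mul_nonneg hN'.le (hc.1 i), ?_, ?_, fun d hd => ?_⟩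
  · simp only [Pi.smul_apply, smul_eq_mul, ← Finset.mul_sum, hc.2, mul_one]
  · rw [hscale]
    positivity
  · rw [hscale]
    calc (N : ℝ) ^ N * (frameMatrix Φ d).det
        ≤ (N : ℝ) ^ N * ((∑ i, d i) ^ N * (frameMatrix Φ c).det) := by
          gcongr
          exact hmax' d hd
      _ = _ := by ring

/-- The equivalence theorem of Kiefer and Wolfowitz: the inverse of the frame matrix of a
D-optimal design defines an ellipsoid containing the frame vectors. -/
theorem inv_frameMatrix_dotProduct_le_one {c : Fin M → ℝ} (hN : 0 < N) (hc : ∀ i, 0 ≤ c i)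
    (hsum : ∑ i, c i = N) (hdet : 0 < (frameMatrix Φ c).det)
    (hmax : ∀ d : Fin M → ℝ, (∀ i, 0 ≤ d i) →
      (N : ℝ) ^ N * (frameMatrix Φ d).det ≤ (∑ i, d i) ^ N * (frameMatrix Φ c).det)
    (i : Fin M) : (frameMatrix Φ c)⁻¹ *ᵥ (Φ i).ofLp ⬝ᵥ (Φ i).ofLp ≤ 1 := by
  have hN' : (0 : ℝ) < N := by exact_mod_cast hN
  set q := (frameMatrix Φ c)⁻¹ *ᵥ (Φ i).ofLp ⬝ᵥ (Φ i).ofLp with hq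
  -- First-order optimality: adding `s` to the weight `c i` multiplies the determinant by `1 + s q`,
  -- which optimality bounds by `(1 + s/N)^N ≤ exp s ≤ 1 + s + s²`.
  have hs : ∀ s : ℝ, 0 < s → s ≤ 1 → q ≤ 1 + s := by
    intro s hs0 hs1
    have hd : ∀ j, 0 ≤ (c + Pi.single i s : Fin M → ℝ) j := 
      have hsingle : (0 : Fin M → ℝ) ≤ Pi.single i s := Pi.single_nonneg.mpr hs0.le
      fun j => add_nonneg (hc j) (hsingle j)
    have h := hmax _ hd
    have hsum' : ∑ j, (c + Pi.single i s : Fin M → ℝ) j = N + s := by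
      simp [Finset.sum_add_distrib, hsum]
    rw [frameMatrix_add_single, Matrix.det_add_smul_vecMulVec (isUnit_iff_ne_zero.mpr hdet.ne'),
      ← hq, hsum'] at h
    have h1 : 1 + s * q ≤ (1 + s / N) ^ N := by
      have e : (N + s : ℝ) = N * (1 + s / N) := by field_simp
      rw [e, mul_pow] at h
      have hp : (0 : ℝ) < N ^ N * (frameMatrix Φ c).det := by positivity
      refine le_of_mul_le_mul_left ?_ hp
      linarith
    have h2 : (1 + s / N) ^ N ≤ Real.exp s := by
      calc (1 + s / N) ^ N ≤ Real.exp (s / N) ^ N := by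
            gcongr
            linarith [Real.add_one_le_exp (s / N)]
        _ = Real.exp s := by
            rw [← Real.exp_nat_mul]
            congr 1
            field_simp
    have h3 := (abs_le.mp (Real.abs_exp_sub_one_sub_id_le (x := s)
      (by rw [abs_of_pos hs0]; exact hs1))).2
    have h4 : s * q ≤ s * (1 + s) := by nlinarith
    exact le_of_mul_le_mul_left h4 hs0
  by_contra! hlt
  have := hs (min 1 ((q - 1) / 2)) (by
    refine lt_min one_pos ?_
    linarith) (min_le_left _ _)
  have h5 := min_le_right 1 ((q - 1) / 2)
  linarith

end UnitFrame

/-! ### The minimal ellipsoid and its volume. -/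

namespace UnitFrame

variable {M N : ℕ} {Φ : Fin M → E N}

theorem ellipsoid_transpose_mul_self (B : Matrix (Fin N) (Fin N) ℝ) (c : E N) :
    ellipsoid (Bᵀ * B) c
      = (fun v => v + -c) ⁻¹' (Matrix.toEuclideanLin B ⁻¹' Metric.closedBall 0 1) := by
  ext v
  have h : ((Bᵀ * B) *ᵥ (v - c).ofLp) ⬝ᵥ (v - c).ofLp
      = ‖Matrix.toEuclideanLin B (v - c)‖ ^ 2 := by
    rw [← dotProduct_self_eq_norm_sq, ← Matrix.mulVec_mulVec, Matrix.mulVec_transpose,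
      ← Matrix.dotProduct_mulVec]
    rfl
  simp only [ellipsoid, Set.mem_ofPred_eq, Set.mem_preimage, mem_closedBall_zero_iff, h,
    ← sub_eq_add_neg]
  exact sq_le_one_iff₀ (norm_nonneg _)

theorem convex_ellipsoid {X : Matrix (Fin N) (Fin N) ℝ} (hX : X.PosSemidef) (c : E N) :
    Convex ℝ (ellipsoid X c) := by
  obtain ⟨B, rfl⟩ := hX.exists_factor
  rw [ellipsoid_transpose_mul_self]
  exact ((convex_closedBall 0 1).linear_preimage (Matrix.toEuclideanLin B)).translate_preimage_left
    (-c)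

theorem volume_ellipsoid {X : Matrix (Fin N) (Fin N) ℝ} (hX : X.PosDef) (c : E N) :
    volume (ellipsoid X c)
      = ENNReal.ofReal (√X.det)⁻¹ * volume (Metric.closedBall (0 : E N) 1) := by
  have hdet := hX.det_pos
  obtain ⟨B, rfl⟩ := hX.posSemidef.exists_factor
  have hB : LinearMap.det (Matrix.toEuclideanLin B) = B.det := LinearMap.det_toLpLin 2 B
  rw [Matrix.det_mul, Matrix.det_transpose] at hdet ⊢
  have hB0 : B.det ≠ 0 := by
    rintro h
    simp [h] at hdet
  rw [ellipsoid_transpose_mul_self, measure_preimage_add_right,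
    Measure.addHaar_preimage_linearMap _ (by rwa [hB]), hB, Real.sqrt_mul_self_eq_abs, abs_inv]

theorem mem_symmetrization (Φ : Fin M → E N) (i : Fin M) :
    Φ i ∈ symmetrization Φ ∧ -Φ i ∈ symmetrization Φ :=
  ⟨Or.inl ⟨i, rfl⟩, Or.inr ⟨i, rfl⟩⟩

/-- Averaging the conditions at `Φ i` and `-Φ i` cancels the terms linear in the centre and leaves a
nonnegative term in `c`, so off-centre ellipsoids gain nothing. -/
theorem dotProduct_le_one_of_subset_ellipsoid {X : Matrix (Fin N) (Fin N) ℝ} (hX : X.PosSemidef)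
    {c : E N} (h : convexHull ℝ (symmetrization Φ) ⊆ ellipsoid X c) (i : Fin M) :
    X *ᵥ (Φ i).ofLp ⬝ᵥ (Φ i).ofLp ≤ 1 := by
  have h1 := h (subset_convexHull ℝ _ (mem_symmetrization Φ i).1)
  have h2 := h (subset_convexHull ℝ _ (mem_symmetrization Φ i).2)
  have h3 : 0 ≤ X *ᵥ c.ofLp ⬝ᵥ c.ofLp := by
    rw [dotProduct_comm]
    simpa using hX.dotProduct_mulVec_nonneg c.ofLp
  simp only [ellipsoid, Set.mem_ofPred_eq, WithLp.ofLp_sub, WithLp.ofLp_neg, Matrix.mulVec_sub,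
    Matrix.mulVec_neg, sub_dotProduct, dotProduct_sub, neg_dotProduct, dotProduct_neg] at h1 h2
  linarith

theorem convexHull_symmetrization_subset_ellipsoid {X : Matrix (Fin N) (Fin N) ℝ}
    (hX : X.PosSemidef) (h : ∀ i, X *ᵥ (Φ i).ofLp ⬝ᵥ (Φ i).ofLp ≤ 1) :
    convexHull ℝ (symmetrization Φ) ⊆ ellipsoid X 0 := by
  refine convexHull_min ?_ (convex_ellipsoid hX 0)
  rintro _ (⟨i, rfl⟩ | ⟨i, rfl⟩) <;> simpa [ellipsoid, Matrix.mulVec_neg] using h i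

/-- Weak duality: for a competitor `X`, `tr(X S) = ∑ c_i φ_iᵀ X φ_i ≤ N`, hence `det X * det S ≤ 1`.
-/
theorem isMinimalEllipsoid_inv_frameMatrix (hN : 0 < N) {c : Fin M → ℝ} (hc : ∀ i, 0 ≤ c i)
    (hsum : ∑ i, c i = N) (hdet : 0 < (frameMatrix Φ c).det)
    (hle : ∀ i, (frameMatrix Φ c)⁻¹ *ᵥ (Φ i).ofLp ⬝ᵥ (Φ i).ofLp ≤ 1) :
    IsMinimalEllipsoid (convexHull ℝ (symmetrization Φ)) (ellipsoid (frameMatrix Φ c)⁻¹ 0) := by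
  have hN' : (0 : ℝ) < N := by exact_mod_cast hN
  have hpsd := posSemidef_frameMatrix Φ hc
  have hX : (frameMatrix Φ c)⁻¹.PosDef := (hpsd.posDef_iff_det_ne_zero.mpr hdet.ne').inv
  refine ⟨⟨_, _, hX, rfl⟩, convexHull_symmetrization_subset_ellipsoid hX.posSemidef hle, ?_⟩
  rintro _ ⟨X, b, hXb, rfl⟩ hsub
  rw [volume_ellipsoid hX, volume_ellipsoid hXb]
  gcongr
  · exact Real.sqrt_pos.mpr hXb.det_pos
  have htr : (X * frameMatrix Φ c).trace ≤ N := by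
    rw [trace_mul_frameMatrix, ← hsum]
    exact Finset.sum_le_sum fun i _ => mul_le_of_le_one_right (hc i)
      (dotProduct_le_one_of_subset_ellipsoid hXb.posSemidef hsub i)
  have htr0 : 0 ≤ (X * frameMatrix Φ c).trace := by
    obtain ⟨B, hB⟩ := hXb.posSemidef.exists_factor
    have := (hpsd.mul_mul_conjTranspose_same B).trace_nonneg
    rwa [Matrix.conjTranspose_eq_transpose_of_trivial, Matrix.trace_mul_cycle, ← hB] at this
  have h := hXb.posSemidef.det_mul_det_le hpsd
  rw [Fintype.card_fin] at h
  have h1 : X.det * (frameMatrix Φ c).det ≤ 1 :=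
    h.trans (pow_le_one₀ (by positivity) ((div_le_one hN').mpr htr))
  rw [Matrix.det_nonsing_inv, Ring.inverse_eq_inv']
  exact (le_inv_mul_iff₀ hdet).mpr (by linarith) |>.trans_eq (mul_one _)

theorem normalizedVolume_eq_sqrt_det (hN : 0 < N) {c : Fin M → ℝ} (hc : ∀ i, 0 ≤ c i)
    (hsum : ∑ i, c i = N) (hdet : 0 < (frameMatrix Φ c).det)
    (hle : ∀ i, (frameMatrix Φ c)⁻¹ *ᵥ (Φ i).ofLp ⬝ᵥ (Φ i).ofLp ≤ 1) :
    normalizedVolume Φ = √(frameMatrix Φ c).det := by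
  have hmin := isMinimalEllipsoid_inv_frameMatrix hN hc hsum hdet hle
  have hX : (frameMatrix Φ c)⁻¹.PosDef :=
    ((posSemidef_frameMatrix Φ hc).posDef_iff_det_ne_zero.mpr hdet.ne').inv
  have heps : IsMinimalEllipsoid (convexHull ℝ (symmetrization Φ)) (minimalEllipsoid Φ) :=
    Classical.epsilon_spec ⟨_, hmin⟩
  -- Any two minimal ellipsoids have equal volume, so uniqueness is not needed.
  have hvol : volume (minimalEllipsoid Φ) = volume (ellipsoid (frameMatrix Φ c)⁻¹ 0) :=
    le_antisymm (heps.2.2 _ hmin.1 hmin.2.1) (hmin.2.2 _ heps.1 heps.2.1)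
  have hball : 0 < (volume (Metric.closedBall (0 : E N) 1)).toReal :=
    ENNReal.toReal_pos (Metric.measure_closedBall_pos _ _ one_pos).ne'
      measure_closedBall_lt_top.ne
  rw [normalizedVolume, hvol, volume_ellipsoid hX, ENNReal.toReal_mul,
    ENNReal.toReal_ofReal (by positivity), mul_div_assoc, div_self hball.ne', mul_one,
    Matrix.det_nonsing_inv, Ring.inverse_eq_inv', Real.sqrt_inv, inv_inv]

end UnitFrame

/-! ### Distance to the cone and its comparison with the volume. -/

namespace UnitFrame

variable {M N : ℕ} {Φ : Fin M → E N}

section Frobenius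

attribute [local instance] Matrix.frobeniusNormedAddCommGroup

theorem coneDist_nonneg (Φ : Fin M → E N) : 0 ≤ coneDist Φ :=
  Real.iInf_nonneg fun _ => norm_nonneg _

theorem coneDist_le (Φ : Fin M → E N) {c : Fin M → ℝ} (hc : ∀ i, 0 ≤ c i) :
    coneDist Φ ≤ ‖frameMatrix Φ c - 1‖ :=
  ciInf_le (f := fun c : {c : Fin M → ℝ // ∀ i, 0 ≤ c i} => ‖frameMatrix Φ c.1 - 1‖)
    ⟨0, by rintro _ ⟨_, rfl⟩; exact norm_nonneg _⟩ ⟨c, hc⟩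

theorem le_coneDist (Φ : Fin M → E N) {r : ℝ}
    (h : ∀ c : Fin M → ℝ, (∀ i, 0 ≤ c i) → r ≤ ‖frameMatrix Φ c - 1‖) : r ≤ coneDist Φ :=
  have : Nonempty {c : Fin M → ℝ // ∀ i, 0 ≤ c i} := ⟨⟨0, fun _ => le_rfl⟩⟩
  le_ciInf fun c => h c.1 c.2

theorem norm_frameMatrix_sub_one_sq (Φ : Fin M → E N) {c : Fin M → ℝ} (hc : ∀ i, 0 ≤ c i) :
    ‖frameMatrix Φ c - 1‖ ^ 2 = (frameMatrix Φ c * frameMatrix Φ c).trace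
      - 2 * (frameMatrix Φ c).trace + N := by
  rw [Matrix.frobenius_norm_sub_one_sq (posSemidef_frameMatrix Φ hc).1, Fintype.card_fin]

/-- The distance to the ray spanned by a single frame matrix bounds the distance to the cone. -/
theorem sq_trace_le_mul_trace_mul_self (Φ : Fin M → E N) {c : Fin M → ℝ} (hc : ∀ i, 0 ≤ c i)
    (hpos : 0 < (frameMatrix Φ c * frameMatrix Φ c).trace)
    (htr : 0 ≤ (frameMatrix Φ c).trace) :
    (frameMatrix Φ c).trace ^ 2
      ≤ (N - coneDist Φ ^ 2) * (frameMatrix Φ c * frameMatrix Φ c).trace := by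
  set p := (frameMatrix Φ c).trace
  set q := (frameMatrix Φ c * frameMatrix Φ c).trace with hq
  -- The factor `p / q` minimizes `a² q - 2 a p + N` over `a`.
  have hs : ∀ i, 0 ≤ ((p / q) • c) i := fun i => mul_nonneg (by positivity) (hc i)
  have h := pow_le_pow_left₀ (coneDist_nonneg Φ) (coneDist_le Φ hs) 2
  rw [norm_frameMatrix_sub_one_sq Φ hs, frameMatrix_smul] at h
  simp only [Matrix.smul_mul, Matrix.mul_smul, Matrix.trace_smul, smul_eq_mul, ← hq] at h
  have e : p / q * (p / q * q) - 2 * (p / q * p) + N = N - p ^ 2 / q := by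
    field_simp
    ring
  change coneDist Φ ^ 2 ≤ p / q * (p / q * q) - 2 * (p / q * p) + N at h
  rw [e] at h
  rw [← div_le_iff₀ hpos]
  linarith

/-- The volume bounds, in a form free of division. -/
theorem volume_coneDist_bounds (hN : 2 ≤ N) (hΦ : IsUnitNormFrame Φ) :
    0 < normalizedVolume Φ ∧ coneDist Φ ^ 2 ≤ N - 1 ∧
    (N : ℝ) * (1 - normalizedVolume Φ ^ ((4 : ℝ) / N))
      ≤ coneDist Φ ^ 2 * (N - normalizedVolume Φ ^ ((4 : ℝ) / N)) ∧
    normalizedVolume Φ ^ ((4 : ℝ) / N) * ((N - 1) * (N - coneDist Φ ^ 2))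
      ≤ N * (N - 1 - coneDist Φ ^ 2) := by
  have hN0 : 0 < N := by omega
  have hN2 : (2 : ℝ) ≤ N := by exact_mod_cast hN
  have hN' : (0 : ℝ) < N := by linarith
  obtain ⟨c, hc, hsum, hdet, hmax⟩ := exists_det_frameMatrix_max hN0 hΦ.1
  have hV := normalizedVolume_eq_sqrt_det hN0 hc hsum hdet
    (inv_frameMatrix_dotProduct_le_one hN0 hc hsum hdet hmax)
  have hpsd := posSemidef_frameMatrix Φ hc
  have hW : normalizedVolume Φ ^ ((4 : ℝ) / N) = (frameMatrix Φ c).det ^ (2 / (N : ℝ)) := by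
    rw [hV, Real.sqrt_eq_rpow, ← Real.rpow_mul hdet.le]
    congr 1
    ring
  rw [hW]
  set W := (frameMatrix Φ c).det ^ (2 / (N : ℝ)) with hWdef
  have hW0 : 0 < W := Real.rpow_pos_of_pos hdet _
  have htr : (frameMatrix Φ c).trace = N := by rw [trace_frameMatrix hΦ.2, hsum]
  set q := (frameMatrix Φ c * frameMatrix Φ c).trace with hq
  have hmac := hpsd.det_rpow_two_div_card_le (by simpa using hN)
  rw [Fintype.card_fin, htr, ← hq] at hmac
  have hqN : q ≤ N ^ 2 := by
    have : (0 : ℝ) ≤ N * (N - 1) * W := mul_nonneg (mul_nonneg hN'.le (by linarith)) hW0.le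
    linarith
  have hq0 : 0 < q := by
    have h := norm_frameMatrix_sub_one_sq Φ hc
    rw [htr, ← hq] at h
    nlinarith [sq_nonneg ‖frameMatrix Φ c - 1‖]
  have hray := sq_trace_le_mul_trace_mul_self Φ hc hq0 (by rw [htr]; exact hN'.le)
  rw [htr, ← hq] at hray
  set D2 := coneDist Φ ^ 2 with hD2
  -- Compare `N² ≤ (N - D²) q` with `q ≤ N²`.
  have hND : 1 ≤ N - D2 := by
    by_contra! hlt
    have : (N - D2) * q < 1 * q := mul_lt_mul_of_pos_right hlt hq0
    linarith
  have hW1 : W ≤ 1 := by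
    have h := hpsd.det_le_trace_div_pow
    rw [Fintype.card_fin, htr, div_self hN'.ne', one_pow] at h
    exact Real.rpow_le_one hdet.le h (by positivity)
  refine ⟨by rw [hV]; exact Real.sqrt_pos.mpr hdet, by linarith, ?_, ?_⟩
  · have hNW : 0 < N - W := by linarith
    have hroot : √(N * (1 - W) / (N - W)) ≤ coneDist Φ := by
      refine le_coneDist Φ fun d hd => ?_
      refine Real.sqrt_le_iff.mpr ⟨norm_nonneg _, ?_⟩
      rw [div_le_iff₀ hNW]
      have hdpsd := posSemidef_frameMatrix Φ hd
      have hk := hdpsd.sq_trace_le_kober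
      have hm := hmax d hd
      rw [norm_frameMatrix_sub_one_sq Φ hd]
      rw [← trace_frameMatrix hΦ.2] at hm
      rw [Fintype.card_fin] at hk
      set p := (frameMatrix Φ d).trace with hp
      set r := (frameMatrix Φ d * frameMatrix Φ d).trace with hr
      have hp0 : 0 ≤ p := hdpsd.trace_nonneg
      have hm' : (N : ℝ) ^ 2 * (frameMatrix Φ d).det ^ (2 / (N : ℝ)) ≤ p ^ 2 * W := by
        have h := Real.rpow_le_rpow (mul_nonneg (by positivity) hdpsd.det_nonneg) hm
          (by positivity : (0 : ℝ) ≤ 2 / N)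
        rw [Real.mul_rpow (by positivity) hdpsd.det_nonneg, Real.mul_rpow (by positivity) hdet.le]
          at h
        have e : ∀ a : ℝ, 0 ≤ a → (a ^ N) ^ (2 / (N : ℝ)) = a ^ 2 := fun a ha => by
          rw [← Real.rpow_natCast, ← Real.rpow_mul ha, ← Real.rpow_natCast a 2]
          congr 1
          push_cast
          field_simp
        rwa [e _ hN'.le, e _ hp0] at h
      have h1 : (N - W) * p ^ 2 ≤ N * (N - 1) * r := by nlinarith
      -- Completing the square in `p`; the minimum is at `p = N(N-1)/(N-W)`.
      have h2 : 0 ≤ ((N - W) * p - N * (N - 1)) ^ 2 := sq_nonneg _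
      have h3 : (N : ℝ) * (N - 1) * (N * (1 - W))
          ≤ N * (N - 1) * ((r - 2 * p + N) * (N - W)) := by
        nlinarith [mul_le_mul_of_nonneg_left h1 hNW.le]
      exact le_of_mul_le_mul_left h3 (mul_pos hN' (by linarith))
    have h := pow_le_pow_left₀ (Real.sqrt_nonneg _) hroot 2
    rw [Real.sq_sqrt (div_nonneg (mul_nonneg hN'.le (by linarith)) hNW.le),
      div_le_iff₀ hNW] at h
    exact h
  · have h1 : (N : ℝ) * ((N - 1) * W) * (N - D2) ≤ (N ^ 2 - q) * (N - D2) :=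
      mul_le_mul_of_nonneg_right (by linarith) (by linarith)
    have h2 : (N : ℝ) * (W * ((N - 1) * (N - D2))) ≤ N * (N * (N - 1 - D2)) := by nlinarith
    exact le_of_mul_le_mul_left h2 hN'

end Frobenius

/-- Two-sided comparison of the volume and the distance to the cone. -/
theorem one_sub_volume_le_and_le (hN : 2 ≤ N) (hΦ : IsUnitNormFrame Φ) :
    1 - normalizedVolume Φ ^ ((4 : ℝ) / N) ≤ coneDist Φ ^ 2 ∧
    coneDist Φ ^ 2 ≤ N * (N - 1) * (1 - normalizedVolume Φ ^ ((4 : ℝ) / N)) := by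
  obtain ⟨hV, hD, hlow, hup⟩ := volume_coneDist_bounds hN hΦ
  have hN2 : (2 : ℝ) ≤ N := by exact_mod_cast hN
  have hW0 : 0 < normalizedVolume Φ ^ ((4 : ℝ) / N) := Real.rpow_pos_of_pos hV _
  set W := normalizedVolume Φ ^ ((4 : ℝ) / N)
  have hD0 : 0 ≤ coneDist Φ ^ 2 := sq_nonneg _
  set D2 := coneDist Φ ^ 2
  -- Uses the identity `(N-1)(N-D²) - N(N-1-D²) = D²`.
  have hup' : D2 ≤ (N - 1) * (N - D2) * (1 - W) := by nlinarith
  have hpos : (0 : ℝ) < (N - 1) * (N - D2) := mul_pos (by linarith) (by linarith)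
  have hW1 : 0 ≤ 1 - W := by
    by_contra! h
    have := mul_neg_of_pos_of_neg hpos h
    linarith
  constructor
  · have h1 : D2 * (N - W) ≤ D2 * N := mul_le_mul_of_nonneg_left (by linarith) hD0
    have h2 : (N : ℝ) * (1 - W) ≤ N * D2 := by linarith
    exact le_of_mul_le_mul_left h2 (by linarith)
  · refine hup'.trans (mul_le_mul_of_nonneg_right ?_ hW1)
    nlinarith

end UnitFrame

/-! ### The inequalities in quotient form and the equivalence of limits. -/

theorem theorem3p2 (N : ℕ) (hN : 2 ≤ N) :
    (∀ (M : ℕ) (Φ : Fin M → UnitFrame.E N), UnitFrame.IsUnitNormFrame Φ →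
      (UnitFrame.coneDist Φ < 1 →
        (N : ℝ) * (1 - UnitFrame.coneDist Φ ^ 2) / ((N : ℝ) - UnitFrame.coneDist Φ ^ 2)
          ≤ UnitFrame.normalizedVolume Φ ^ ((4 : ℝ) / (N : ℝ))) ∧
      UnitFrame.normalizedVolume Φ ^ ((4 : ℝ) / (N : ℝ))
        ≤ (N : ℝ) * ((N : ℝ) - 1 - UnitFrame.coneDist Φ ^ 2)
          / (((N : ℝ) - 1) * ((N : ℝ) - UnitFrame.coneDist Φ ^ 2)) ∧
      (N : ℝ) * ((N : ℝ) - 1 - UnitFrame.coneDist Φ ^ 2)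
          / (((N : ℝ) - 1) * ((N : ℝ) - UnitFrame.coneDist Φ ^ 2)) ≤ 1) ∧
    (∀ (ι : Type*) (l : Filter ι) (M : ι → ℕ) (Φ : (k : ι) → Fin (M k) → UnitFrame.E N),
      (∀ k, UnitFrame.IsUnitNormFrame (Φ k)) →
      (Tendsto (fun k => UnitFrame.normalizedVolume (Φ k)) l (𝓝 1) ↔
        Tendsto (fun k => UnitFrame.coneDist (Φ k)) l (𝓝 0))) := by
  have hN2 : (2 : ℝ) ≤ N := by exact_mod_cast hN
  have hN' : (0 : ℝ) < N := by linarith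
  refine ⟨fun M Φ hΦ => ?_, fun ι l M Φ hΦ => ?_⟩
  · obtain ⟨hV, hD, hlow, hup⟩ := UnitFrame.volume_coneDist_bounds hN hΦ
    have hD0 : 0 ≤ UnitFrame.coneDist Φ ^ 2 := sq_nonneg _
    have hpos : 0 < (N : ℝ) - UnitFrame.coneDist Φ ^ 2 := by linarith
    have hpos' : 0 < ((N : ℝ) - 1) * ((N : ℝ) - UnitFrame.coneDist Φ ^ 2) :=
      mul_pos (by linarith) hpos
    refine ⟨fun _ => ?_, ?_, ?_⟩
    · rw [div_le_iff₀ hpos]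
      linarith
    · rwa [le_div_iff₀ hpos']
    · rw [div_le_one hpos']
      linarith
  · have hcomp := fun k => UnitFrame.one_sub_volume_le_and_le hN (hΦ k)
    constructor
    · intro h
      have hW : Tendsto (fun k => (N : ℝ) * (N - 1) *
          (1 - UnitFrame.normalizedVolume (Φ k) ^ ((4 : ℝ) / N))) l (𝓝 0) := by
        have := ((h.rpow_const (p := (4 : ℝ) / N) (Or.inl one_ne_zero)).const_sub 1).const_mul
          ((N : ℝ) * (N - 1))
        simpa using this
      have hsq : Tendsto (fun k => UnitFrame.coneDist (Φ k) ^ 2) l (𝓝 0) :=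
        squeeze_zero (fun k => sq_nonneg _) (fun k => (hcomp k).2) hW
      have := hsq.sqrt
      simpa [Real.sqrt_sq (UnitFrame.coneDist_nonneg _)] using this
    · intro h
      have hsq : Tendsto (fun k => UnitFrame.coneDist (Φ k) ^ 2) l (𝓝 0) := by
        simpa using h.pow 2
      have hle : ∀ k, 0 ≤ 1 - UnitFrame.normalizedVolume (Φ k) ^ ((4 : ℝ) / N) := fun k => by
        have h1 := (sq_nonneg _).trans (hcomp k).2
        exact nonneg_of_mul_nonneg_right h1 (mul_pos hN' (by linarith))
      have h0 : Tendsto (fun k => 1 - UnitFrame.normalizedVolume (Φ k) ^ ((4 : ℝ) / N)) l (𝓝 0) :=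
        squeeze_zero hle (fun k => (hcomp k).1) hsq
      have h1 := (h0.const_sub 1).rpow_const (p := (N : ℝ) / 4) (Or.inl (by norm_num))
      simp only [sub_sub_cancel, sub_zero, Real.one_rpow] at h1
      refine h1.congr fun k => ?_
      rw [← Real.rpow_mul (UnitFrame.volume_coneDist_bounds hN (hΦ k)).1.le]
      have : (4 : ℝ) / N * (N / 4) = 1 := by field_simp
      rw [this, Real.rpow_one]
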